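/- Let $R$ be an associative unital (not necessarily commutative) ring and $n\ge 1$. **Conventions.** For a square matrix $A$ over $R$, let $A^{ij}$ be $A$ with row $i$ and column $j$ deleted. The quasi-determinant $$|A|_{ij}=a_{ij}-\sum_{k\ne j,\ l\ne i}a_{ik}\,\bigl((A^{ij})^{-1}\bigr)_{kl}\,a_{lj}$$ is well defined when $A^{ij}$ is invertible over $R$ (for a $1\times1$ matrix $|A|_{ij}=a_{ij}$). $A^{i_1,\dots,i_m}_{j_1,\dots,j_m}$ is the submatrix with the indicated rows (upper indices) and columns (lower indices). Subscripts of the quasi-determinant of a submatrix refer to the labels of rows and columns in the original matrix; in a block matrix made from two matrices, a bar marks the row or column coming from the matrix that carries the bar. $\overrightarrow{\prod}_{k=1}^{m}f_k=f_1f_2\cdots f_m$ and $\overleftarrow{\prod}_{k=1}^{m}f_k=f_m\cdots f_2f_1$; empty products are $1$. **Objects.** An *L-datum* is a quadruple $\mathbf L=(\mathbf L^{+(1)},\mathbf L^{-(1)},\mathbf L^{+(2)},\mathbf L^{-(2)})$ of $n\times n$ matrices over $R$ such that, for $a=1,2$, $\mathbf L^{+(a)}$ is upper triangular with diagonal $\mathbf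 u^{(a)}_1,\dots,\mathbf u^{(a)}_n$ and $\mathbf L^{-(a)}$ is lower triangular with diagonal $\mathbf u^{(a)}_0,\dots,\mathbf u^{(a)}_{n-1}$, where $\mathbf u^{(a)}_0=1$ and all $\mathbf u^{(a)}_k$ are invertible in $R$. For a second L-datum $\widetilde{\mathbf L}$ all these symbols carry a tilde. No further relations (in particular no commutation relations) are assumed. Put $$\mathbf J=\mathbf L^{-(1)}\mathbf L^{+(2)},\quad \mathbb H_k=|\mathbf J^{k,\dots,n}_{k,\dots,n}|_{kk},\qquad \widetilde{\mathbf J}=\widetilde{\mathbf L}^{+(2)}\widetilde{\mathbf L}^{-(1)},\quad \widetilde{\mathbb H}_k=|\widetilde{\mathbf J}^{1,\dots,k}_{1,\dots,k}|_{kk}.$$ Call $\mathbf L$ *regular* if all $\mathbb H_k$ ($1\le k\le n$) are well defined and invertible, and $\widetilde{\mathbf L}$ *co-regular* if all $\widetilde{\mathbb H}_k$ ($1\le k\le n$) are well defined and invertible. The zero-curvature relation between $\mathbf L$ and $\widetilde{\mathbf L}$ is $$\mathbf L^{+(1)}\mathbf L^{+(2)}=\widetilde{\mathbf L}^{+(2)}\widetilde{\mathbf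 L}^{+(1)},\quad \mathbf L^{-(1)}\mathbf L^{+(2)}=\widetilde{\mathbf L}^{+(2)}\widetilde{\mathbf L}^{-(1)},\quad \mathbf L^{-(1)}\mathbf L^{-(2)}=\widetilde{\mathbf L}^{-(2)}\widetilde{\mathbf L}^{-(1)}.\tag{ZC}$$ **The map.** For a regular L-datum $\mathbf L$ define $\mathcal R(\mathbf L)=\widetilde{\mathbf L}$ by the following formulas for $1\le i\le j\le n$, all other entries being $0$: $$\widetilde{\mathbf L}^{+(1)}_{ij}=\Bigl(\overrightarrow{\prod}_{k=1}^{i-1}\mathbb H_k^{-1}\mathbf u^{(1)}_k\mathbf u^{(2)}_k\Bigr)\mathbb H_i^{-1}\,\bigl|(\mathbf L^{+(1)}\mathbf L^{+(2)})^{i,\dots,n}_{\bar j}\ \ \mathbf J^{i,\dots,n}_{i+1,\dots,n}\bigr|_{i\bar j},$$ $$\widetilde{\mathbf L}^{-(1)}_{ji}=\Bigl(\overrightarrow{\prod}_{k=1}^{j-1}\mathbb H_k^{-1}\mathbf u^{(1)}_k\mathbf u^{(2)}_k\Bigr)\mathbb H_j^{-1}\,\bigl|\mathbf J^{j,j+1,\dots,n}_{i,j+1,\dots,n}\bigr|_{ji},$$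 $$\widetilde{\mathbf L}^{+(2)}_{ij}=\bigl|\mathbf J^{i,j+1,\dots,n}_{j,j+1,\dots,n}\bigr|_{ij}\ \overleftarrow{\prod}_{k=1}^{j-1}\bigl((\mathbf u^{(1)}_k\mathbf u^{(2)}_k)^{-1}\mathbb H_k\bigr),$$ $$\widetilde{\mathbf L}^{-(2)}_{ji}=\begin{vmatrix}(\mathbf L^{-(1)}\mathbf L^{-(2)})^{\bar j}_{i,\dots,n}\\ \mathbf J^{i+1,\dots,n}_{i,\dots,n}\end{vmatrix}_{\bar j i}\ \overleftarrow{\prod}_{k=1}^{i-1}\bigl((\mathbf u^{(1)}_k\mathbf u^{(2)}_k)^{-1}\mathbb H_k\bigr).$$ **The inverse formulas.** For a co-regular L-datum $\widetilde{\mathbf L}$ define $\mathcal S(\widetilde{\mathbf L})=\mathbf L$ by the following formulas for $1\le i\le j\le n$, all other entries being $0$: $$\mathbf L^{+(1)}_{ij}=\begin{vmatrix}\widetilde{\mathbf J}^{1,\dots,j-1}_{1,\dots,j}\\ (\widetilde{\mathbf L}^{+(2)}\widetilde{\mathbf L}^{+(1)})^{\bar i}_{1,\dots,j}\end{vmatrix}_{\bar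 i j}\,\widetilde{\mathbb H}_j^{-1}\ \overleftarrow{\prod}_{k=1}^{j-1}\bigl(\widetilde{\mathbf u}^{(2)}_k\widetilde{\mathbf u}^{(1)}_k\widetilde{\mathbb H}_k^{-1}\bigr),$$ $$\mathbf L^{-(1)}_{ji}=\bigl|\widetilde{\mathbf J}^{1,\dots,i-1,j}_{1,\dots,i-1,i}\bigr|_{ji}\,\widetilde{\mathbb H}_i^{-1}\ \overleftarrow{\prod}_{k=1}^{i-1}\bigl(\widetilde{\mathbf u}^{(2)}_k\widetilde{\mathbf u}^{(1)}_k\widetilde{\mathbb H}_k^{-1}\bigr),$$ $$\mathbf L^{+(2)}_{ij}=\Bigl(\overrightarrow{\prod}_{k=1}^{i-1}\widetilde{\mathbb H}_k(\widetilde{\mathbf u}^{(2)}_k\widetilde{\mathbf u}^{(1)}_k)^{-1}\Bigr)\bigl|\widetilde{\mathbf J}^{1,\dots,i-1,i}_{1,\dots,i-1,j}\bigr|_{ij},$$ $$\mathbf L^{-(2)}_{ji}=\Bigl(\overrightarrow{\prod}_{k=1}^{j-1}\widetilde{\mathbb H}_k(\widetilde{\mathbf u}^{(2)}_k\widetilde{\mathbf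 u}^{(1)}_k)^{-1}\Bigr)\bigl|\widetilde{\mathbf J}^{1,\dots,j}_{1,\dots,j-1}\ \ (\widetilde{\mathbf L}^{-(2)}\widetilde{\mathbf L}^{-(1)})^{1,\dots,j}_{\bar i}\bigr|_{j\bar i}.$$ **Theorem.** 1. If $\widetilde{\mathbf L}$ is a co-regular L-datum, then $\mathbf L=\mathcal S(\widetilde{\mathbf L})$ is a regular L-datum, the pair $(\mathbf L,\widetilde{\mathbf L})$ satisfies (ZC), and $\mathcal R(\mathcal S(\widetilde{\mathbf L}))=\widetilde{\mathbf L}$. 2. If $\mathbf L$ is a regular L-datum, then $\mathcal R(\mathbf L)$ is a co-regular L-datum and $\mathcal S(\mathcal R(\mathbf L))=\mathbf L$. Thus $\mathcal S$ is the inverse of the map $\mathcal R$. 3. If two L-data $\mathbf L$, $\widetilde{\mathbf L}$ satisfy (ZC), then $\widetilde{\mathbf L}$ is co-regular and $\mathbf L=\mathcal S(\widetilde{\mathbf L})$. -/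

import Mathlib

namespace QYB

section

variable {R : Type*} [Ring R] {n : ℕ}

/-- The square matrix obtained from `A` by deleting the row `i` and the column `j`. -/
def minorMat {m : ℕ} (A : Matrix (Fin (m + 1)) (Fin (m + 1)) R) (i j : Fin (m + 1)) :
    Matrix (Fin m) (Fin m) R :=
  A.submatrix i.succAbove j.succAbove

/-- The `(i, j)` quasi-determinant of `A` is well defined: the complementary submatrix is
invertible over the (noncommutative) ring `R`. -/
def QuasiDetDefined {m : ℕ} (A : Matrix (Fin (m + 1)) (Fin (m + 1)) R)
    (i j : Fin (m + 1)) : Prop :=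
  IsUnit (minorMat A i j)

/-- The quasi-determinant `|A|_{ij} = a_{ij} - ∑ a_{ik} ((A^{ij})⁻¹)_{kl} a_{lj}`, the sum over
all columns `k ≠ j` and all rows `l ≠ i`. Here `i`, `j` are positions in `A`. The value is
meaningful when `QuasiDetDefined A i j`. -/
noncomputable def quasiDet {m : ℕ} (A : Matrix (Fin (m + 1)) (Fin (m + 1)) R)
    (i j : Fin (m + 1)) : R :=
  A i j - ∑ k : Fin m, ∑ l : Fin m,
    A i (j.succAbove k) * Ring.inverse (minorMat A i j) k l * A (i.succAbove l) j

/-- The ordered product `f 0 * f 1 * ⋯ * f (i - 1)`, over the indices before `i`. -/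
def prodUp (i : Fin n) (f : Fin n → R) : R :=
  (List.ofFn fun k : Fin i => f ⟨k, k.isLt.trans i.isLt⟩).prod

/-- The ordered product `f (i - 1) * ⋯ * f 1 * f 0`, over the indices before `i`. -/
def prodDown (i : Fin n) (f : Fin n → R) : R :=
  (List.ofFn fun k : Fin i => f ⟨k, k.isLt.trans i.isLt⟩).reverse.prod

/-- The indices strictly before `i`, in increasing order. -/
def before (i : Fin n) (k : Fin i) : Fin n := ⟨k, k.isLt.trans i.isLt⟩

/-- The indices strictly after `i`, in increasing order. -/
def after (i : Fin n) (k : Fin (n - 1 - i)) : Fin n :=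
  ⟨i + 1 + k, by have := k.isLt; omega⟩

/-- The index sequence: all indices strictly before `i`, then `j`. -/
def beforeThen (i j : Fin n) : Fin (i + 1) → Fin n :=
  Fin.snoc (α := fun _ => Fin n) (before i) j

/-- The index sequence: `j`, then all indices strictly after `i`. -/
def thenAfter (j i : Fin n) : Fin (n - 1 - i + 1) → Fin n :=
  Fin.cons (α := fun _ => Fin n) j (after i)

/-! ### The L-operators -/

/-- Four `n × n` matrices `L^{+(1)}`, `L^{-(1)}`, `L^{+(2)}`, `L^{-(2)}` over `R`. -/
@[ext]
structure LData (n : ℕ) (R : Type*) where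
  p1 : Matrix (Fin n) (Fin n) R
  m1 : Matrix (Fin n) (Fin n) R
  p2 : Matrix (Fin n) (Fin n) R
  m2 : Matrix (Fin n) (Fin n) R

/-- `P` is upper triangular with diagonal `u_1, …, u_n` and `M` is lower triangular with diagonal
`u_0, …, u_{n-1}`, for some invertible `u_0 = 1, u_1, …, u_n`. -/
def IsLPair (P M : Matrix (Fin n) (Fin n) R) : Prop :=
  ∃ u : Fin (n + 1) → Rˣ, u 0 = 1 ∧
    (∀ i j, j < i → P i j = 0) ∧ (∀ i j, i < j → M i j = 0) ∧
    (∀ i : Fin n, P i i = u i.succ) ∧ (∀ i : Fin n, M i i = u i.castSucc)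

/-- Both pairs `L^{±(1)}` and `L^{±(2)}` have the form required of L-operators. -/
def LData.Admissible (X : LData n R) : Prop :=
  IsLPair X.p1 X.m1 ∧ IsLPair X.p2 X.m2

/-- The zero-curvature relation between `X = (L^{±(1)}, L^{±(2)})` and
`Y = (L̃^{±(1)}, L̃^{±(2)})`. -/
def ZeroCurvature (X Y : LData n R) : Prop :=
  X.p1 * X.p2 = Y.p2 * Y.p1 ∧
  X.m1 * X.p2 = Y.p2 * Y.m1 ∧
  X.m1 * X.m2 = Y.m2 * Y.m1

/-- `J = L^{-(1)} L^{+(2)}`. -/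
def LData.J (X : LData n R) : Matrix (Fin n) (Fin n) R := X.m1 * X.p2

/-- `J̃ = L̃^{+(2)} L̃^{-(1)}`. -/
def LData.Jt (Y : LData n R) : Matrix (Fin n) (Fin n) R := Y.p2 * Y.m1

/-! ### The map -/

/-- The quasi-determinant `|A^{i, j+1, …, n}_{k, j+1, …, n}|_{ik}`. -/
noncomputable def qTail (A : Matrix (Fin n) (Fin n) R) (j i k : Fin n) : R :=
  quasiDet (A.submatrix (thenAfter i j) (thenAfter k j)) 0 0

/-- `H_k = |A^{k, …, n}_{k, …, n}|_{kk}`. -/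
noncomputable def hTail (A : Matrix (Fin n) (Fin n) R) (k : Fin n) : R := qTail A k k k

/-- All the `H_k` are well defined and invertible. -/
def TailRegular (A : Matrix (Fin n) (Fin n) R) : Prop :=
  ∀ k, QuasiDetDefined (A.submatrix (thenAfter k k) (thenAfter k k)) 0 0 ∧ IsUnit (hTail A k)

/-- The square matrix whose first column is the column `j` of `M`, followed by the columns
`i+1, …, n` of `A`, all restricted to the rows `i, …, n`. -/
def colTail (M A : Matrix (Fin n) (Fin n) R) (i j : Fin n) :
    Matrix (Fin (n - 1 - i + 1)) (Fin (n - 1 - i + 1)) R :=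
  Matrix.of fun r => Fin.cons (α := fun _ => R) (M (thenAfter i i r) j)
    (fun c => A (thenAfter i i r) (after i c))

/-- The square matrix whose first row is the row `j` of `M`, followed by the rows
`i+1, …, n` of `A`, all restricted to the columns `i, …, n`. -/
def rowTail (M A : Matrix (Fin n) (Fin n) R) (j i : Fin n) :
    Matrix (Fin (n - 1 - i + 1)) (Fin (n - 1 - i + 1)) R :=
  Matrix.of fun r c => Fin.cons (α := fun _ => R) (M j (thenAfter i i c))
    (fun k => A (after i k) (thenAfter i i c)) r

/-- The map `(L^{±(1)}, L^{±(2)}) ↦ (L̃^{±(1)}, L̃^{±(2)})` given by quasi-determinants in `J`,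
`L^{+(1)} L^{+(2)}` and `L^{-(1)} L^{-(2)}`; here `u_k^{(a)} = L^{+(a)}_{kk}`. Every
quasi-determinant in it has some `J^{k+1, …, n}_{k+1, …, n}` as complementary submatrix, so all of
them are well defined when `TailRegular X.J`. -/
noncomputable def forwardMap (X : LData n R) : LData n R where
  p1 := Matrix.of fun i j => if i ≤ j then
      prodUp i (fun k => Ring.inverse (hTail X.J k) * (X.p1 k k * X.p2 k k)) *
        Ring.inverse (hTail X.J i) * quasiDet (colTail (X.p1 * X.p2) X.J i j) 0 0
    else 0
  m1 := Matrix.of fun j i => if i ≤ j then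
      prodUp j (fun k => Ring.inverse (hTail X.J k) * (X.p1 k k * X.p2 k k)) *
        Ring.inverse (hTail X.J j) * qTail X.J j j i
    else 0
  p2 := Matrix.of fun i j => if i ≤ j then
      qTail X.J j i j *
        prodDown j (fun k => Ring.inverse (X.p1 k k * X.p2 k k) * hTail X.J k)
    else 0
  m2 := Matrix.of fun j i => if i ≤ j then
      quasiDet (rowTail (X.m1 * X.m2) X.J j i) 0 0 *
        prodDown i (fun k => Ring.inverse (X.p1 k k * X.p2 k k) * hTail X.J k)
    else 0

/-! ### The inverse map -/

/-- The quasi-determinant `|A^{1, …, i-1, j}_{1, …, i-1, k}|_{jk}`. -/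
noncomputable def qInit (A : Matrix (Fin n) (Fin n) R) (i j k : Fin n) : R :=
  quasiDet (A.submatrix (beforeThen i j) (beforeThen i k)) (Fin.last i) (Fin.last i)

/-- `H̃_k = |A^{1, …, k}_{1, …, k}|_{kk}`. -/
noncomputable def hInit (A : Matrix (Fin n) (Fin n) R) (k : Fin n) : R := qInit A k k k

/-- All the `H̃_k` are well defined and invertible. -/
def InitRegular (A : Matrix (Fin n) (Fin n) R) : Prop :=
  ∀ k : Fin n, QuasiDetDefined (A.submatrix (beforeThen k k) (beforeThen k k))
    (Fin.last k) (Fin.last k) ∧ IsUnit (hInit A k)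

/-- The square matrix whose rows are the rows `1, …, j-1` of `A`, followed by the row `i` of `M`,
all restricted to the columns `1, …, j`. -/
def rowInit (A M : Matrix (Fin n) (Fin n) R) (i j : Fin n) :
    Matrix (Fin (j + 1)) (Fin (j + 1)) R :=
  Matrix.of fun r c => Fin.snoc (α := fun _ => R)
    (fun k => A (before j k) (beforeThen j j c)) (M i (beforeThen j j c)) r

/-- The square matrix whose columns are the columns `1, …, j-1` of `A`, followed by the column `i`
of `M`, all restricted to the rows `1, …, j`. -/
def colInit (A M : Matrix (Fin n) (Fin n) R) (j i : Fin n) :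
    Matrix (Fin (j + 1)) (Fin (j + 1)) R :=
  Matrix.of fun r => Fin.snoc (α := fun _ => R)
    (fun k => A (beforeThen j j r) (before j k)) (M (beforeThen j j r) i)

/-- The map `(L̃^{±(1)}, L̃^{±(2)}) ↦ (L^{±(1)}, L^{±(2)})` given by quasi-determinants in `J̃`,
`L̃^{+(2)} L̃^{+(1)}` and `L̃^{-(2)} L̃^{-(1)}`; here `ũ_k^{(a)} = L̃^{+(a)}_{kk}`. Every
quasi-determinant in it has some `J̃^{1, …, k-1}_{1, …, k-1}` as complementary submatrix, so all of
them are well defined when `InitRegular Y.Jt`. -/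
noncomputable def backwardMap (Y : LData n R) : LData n R where
  p1 := Matrix.of fun i j => if i ≤ j then
      quasiDet (rowInit Y.Jt (Y.p2 * Y.p1) i j) (Fin.last j) (Fin.last j) *
        Ring.inverse (hInit Y.Jt j) *
        prodDown j (fun k => Y.p2 k k * Y.p1 k k * Ring.inverse (hInit Y.Jt k))
    else 0
  m1 := Matrix.of fun j i => if i ≤ j then
      qInit Y.Jt i j i * Ring.inverse (hInit Y.Jt i) *
        prodDown i (fun k => Y.p2 k k * Y.p1 k k * Ring.inverse (hInit Y.Jt k))
    else 0
  p2 := Matrix.of fun i j => if i ≤ j then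
      prodUp i (fun k => hInit Y.Jt k * Ring.inverse (Y.p2 k k * Y.p1 k k)) *
        qInit Y.Jt i i j
    else 0
  m2 := Matrix.of fun j i => if i ≤ j then
      prodUp j (fun k => hInit Y.Jt k * Ring.inverse (Y.p2 k k * Y.p1 k k)) *
        quasiDet (colInit Y.Jt (Y.m2 * Y.m1) j i) (Fin.last j) (Fin.last j)
    else 0

end

end QYB

/-! The middle equation of (ZC) says that one matrix has two triangular factorizations: `X.m1 *
X.p2` is lower times upper, `Y.p2 * Y.m1` upper times lower. For a product `L * U`, the
quasi-determinant bordering the leading block before `i` at row `j`, column `k` is `L j i * U i k`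
as soon as `j = i` or `k = i`; trailing blocks of `U * L` behave the same way
(`quasiDet_last_of_factor`, `quasiDet_zero_of_factor`). Borders taken from the outer products of
(ZC) give the entries of the other two matrices.

Only diagonal factors remain to be separated. In terms of `X`, `H̃_k = u⁽¹⁾_{k-1} u⁽²⁾_k`, while the
diagonal of the first equation gives `ũ⁽²⁾_k ũ⁽¹⁾_k = u⁽¹⁾_k u⁽²⁾_k`. The ordered products therefore
telescope to `u⁽¹⁾` or its inverse, with no commutativity. Hence each member of a solution is given
by the formulas in the other (`initRegular_and_eq`, `tailRegular_and_eq`).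

Conversely, regularity yields an LU or UL factorization by elimination. A diagonal rescaling gives
it the prescribed diagonals, and the outer equations are solved for the two missing matrices
(`exists_zeroCurvature_left`, `exists_zeroCurvature_right`). Existence combined with determination
in both directions makes the two maps mutually inverse. -/

namespace QYB

/-! ### Triangular matrices over a noncommutative ring -/

section Triangular

open Matrix

variable {R : Type*} [Ring R] {ι : Type*} [Fintype ι] [DecidableEq ι]

theorem pow_apply_eq_zero_of_strict {b : ι → ℕ} {N : Matrix ι ι R}
    (hN : ∀ i j, b j ≤ b i → N i j = 0) (k : ℕ) :
    ∀ i j, b j < b i + k → (N ^ k) i j = 0 := by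
  induction k with
  | zero =>
    intro i j h
    rw [pow_zero, Matrix.one_apply_ne]
    rintro rfl
    omega
  | succ k ih =>
    intro i j h
    rw [pow_succ, Matrix.mul_apply]
    refine Finset.sum_eq_zero fun l _ => ?_
    by_cases hl : b l < b i + k
    · rw [ih i l hl, zero_mul]
    · rw [hN l j (by omega), mul_zero]

theorem isNilpotent_of_strict {b : ι → ℕ} {N : Matrix ι ι R}
    (hN : ∀ i j, b j ≤ b i → N i j = 0) : IsNilpotent N := by
  refine ⟨∑ i, b i + 1, ?_⟩
  ext i j
  refine pow_apply_eq_zero_of_strict hN _ i j ?_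
  have := Finset.single_le_sum (f := b) (fun _ _ => Nat.zero_le _) (Finset.mem_univ j)
  omega

/-- The block triangular matrices form a subring. -/
def triangularSubring (R : Type*) [Ring R] (b : ι → ℕ) : Subring (Matrix ι ι R) where
  carrier := {M | M.BlockTriangular b}
  mul_mem' := fun h h' => BlockTriangular.mul h h'
  one_mem' := blockTriangular_one
  add_mem' := fun h h' => BlockTriangular.add h h'
  zero_mem' := blockTriangular_zero
  neg_mem' := fun h => BlockTriangular.neg h

/-- A triangular matrix with invertible diagonal over a noncommutative ring has a two-sided
triangular inverse. -/
theorem exists_triangular_inverse {b : ι → ℕ} (hb : Function.Injective b) {M : Matrix ι ι R}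
    (hM : M.BlockTriangular b) (u : ι → Rˣ) (hu : ∀ i, M i i = u i) :
    ∃ N : Matrix ι ι R, N.BlockTriangular b ∧ M * N = 1 ∧ N * M = 1 ∧
      ∀ i, N i i = ((u i)⁻¹ : Rˣ) := by
  let D : Matrix ι ι R := diagonal fun i => ((u i)⁻¹ : Rˣ)
  have hD : D.BlockTriangular b := blockTriangular_diagonal _
  -- Inverting `1 + T` inside the subring makes the inverse triangular at no extra cost; `T` is
  -- nilpotent because `D * M` has unit diagonal.
  let T : triangularSubring R b := ⟨D * M - 1, ((hD.mul hM).sub blockTriangular_one)⟩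
  have hT : IsNilpotent T := by
    obtain ⟨k, hk⟩ := isNilpotent_of_strict (b := b) (N := D * M - 1) (by
      intro i j hij
      rcases hij.lt_or_eq with h | h
      · exact ((hD.mul hM).sub blockTriangular_one) h
      · obtain rfl := hb h
        simp [D, diagonal_mul, hu])
    exact ⟨k, Subtype.ext (by simpa using hk)⟩
  obtain ⟨⟨P, Q, hPQ, hQP⟩, hP⟩ := hT.isUnit_one_add
  have hPM : (P : Matrix ι ι R) = D * M := by
    have := congrArg Subtype.val hP
    simpa [T] using this
  have h1 : D * M * Q = 1 := by rw [← hPM]; exact congrArg Subtype.val hPQ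
  have h2 : (Q : Matrix ι ι R) * (D * M) = 1 := by rw [← hPM]; exact congrArg Subtype.val hQP
  let E : Matrix ι ι R := diagonal fun i => (u i : R)
  have hED : E * D = 1 := by simp [E, D, diagonal_mul_diagonal]
  have hDE : D * E = 1 := by simp [E, D, diagonal_mul_diagonal]
  have hMN : M * (Q * D) = 1 := by
    calc M * (Q * D) = E * D * M * (Q * D) := by rw [hED, one_mul]
      _ = E * (D * M * Q) * D := by simp only [mul_assoc]
      _ = 1 := by rw [h1, mul_one, hED]
  have hN : ((Q : Matrix ι ι R) * D).BlockTriangular b := BlockTriangular.mul Q.2 hD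
  refine ⟨Q * D, hN, hMN, by rw [mul_assoc, h2], fun i => ?_⟩
  have h := congrFun (congrFun hMN i) i
  rw [mul_apply, Finset.sum_eq_single i, hu, one_apply_eq] at h
  · exact Units.eq_inv_of_mul_eq_one_left h
  · intro l _ hl
    rcases lt_or_gt_of_ne (hb.ne hl) with h | h
    · rw [hM h, zero_mul]
    · rw [hN h, mul_zero]
  · simp

theorem isUnit_of_triangular {b : ι → ℕ} (hb : Function.Injective b) {M : Matrix ι ι R}
    (hM : M.BlockTriangular b) (hu : ∀ i, IsUnit (M i i)) : IsUnit M := by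
  choose u hu using hu
  obtain ⟨N, -, h1, h2, -⟩ := exists_triangular_inverse hb hM u fun i => (hu i).symm
  exact ⟨⟨M, N, h1, h2⟩, rfl⟩

theorem triangular_mul_diag {κ : Type*} [Fintype κ] {b : κ → ℕ} (hb : Function.Injective b) {M N : Matrix κ κ R}
    (hM : M.BlockTriangular b) (hN : N.BlockTriangular b) (i : κ) :
    (M * N) i i = M i i * N i i := by
  rw [mul_apply, Fintype.sum_eq_single i]
  intro l hl
  rcases lt_or_gt_of_ne (hb.ne hl) with h | h
  · rw [hM h, zero_mul]
  · rw [hN h, mul_zero]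

end Triangular

/-! ### Quasi-determinants of factored matrices -/

section QuasiDet

open Matrix

variable {R : Type*} [Ring R] {n : ℕ}

theorem quasiDet_eq_sub_dotProduct {m : ℕ} (A : Matrix (Fin (m + 1)) (Fin (m + 1)) R)
    (p q : Fin (m + 1)) : quasiDet A p q = A p q -
      ((fun c => A p (q.succAbove c)) ᵥ* Ring.inverse (minorMat A p q)) ⬝ᵥ
        fun l => A (p.succAbove l) q := by
  simp only [quasiDet, dotProduct, vecMul, Finset.sum_mul]
  rw [Finset.sum_comm]

/-- The correction term is `v B (C B)⁻¹ C w`, in which both factors cancel: no inverse is left to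
compute. -/
theorem quasiDet_of_minor_factor {m : ℕ} {A : Matrix (Fin (m + 1)) (Fin (m + 1)) R}
    {p q : Fin (m + 1)} {C B : Matrix (Fin m) (Fin m) R} {v w : Fin m → R}
    (hC : IsUnit C) (hB : IsUnit B) (hA : minorMat A p q = C * B)
    (hv : (fun c => A p (q.succAbove c)) = v ᵥ* B)
    (hw : (fun l => A (p.succAbove l) q) = C *ᵥ w) :
    QuasiDetDefined A p q ∧ quasiDet A p q = A p q - v ⬝ᵥ w := by
  obtain ⟨C, rfl⟩ := hC
  obtain ⟨B, rfl⟩ := hB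
  refine ⟨by rw [QuasiDetDefined, hA]; exact (C * B).isUnit, ?_⟩
  rw [quasiDet_eq_sub_dotProduct, hv, hw, hA, ← Units.val_mul, Ring.inverse_unit, _root_.mul_inv_rev,
    Units.val_mul, vecMul_vecMul, ← mul_assoc, Units.mul_inv, one_mul, ← dotProduct_mulVec,
    mulVec_mulVec, Units.inv_mul, one_mulVec]

/-- The coefficients are the row `p` times the inverse minor, so a quasi-determinant is what remains
of an entry after row elimination. -/
theorem exists_row_elimination {m : ℕ} {A : Matrix (Fin (m + 1)) (Fin (m + 1)) R}
    {p q : Fin (m + 1)} (h : QuasiDetDefined A p q) :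
    ∃ v : Fin m → R,
      (∀ c, A p (q.succAbove c) = ∑ l, v l * A (p.succAbove l) (q.succAbove c)) ∧
      quasiDet A p q = A p q - ∑ l, v l * A (p.succAbove l) q := by
  refine ⟨(fun c => A p (q.succAbove c)) ᵥ* Ring.inverse (minorMat A p q), fun c => ?_,
    quasiDet_eq_sub_dotProduct A p q⟩
  have := congrFun (vecMul_vecMul (fun c => A p (q.succAbove c))
    (Ring.inverse (minorMat A p q)) (minorMat A p q)) c
  rw [Ring.inverse_mul_cancel _ h, vecMul_one] at this
  exact this.symm

theorem sum_comp_of_eq_zero {m : ℕ} {e : Fin m → Fin n} (he : Function.Injective e)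
    {f : Fin n → R} (hf : ∀ x, x ∉ Set.range e → f x = 0) : ∑ x, f x = ∑ l, f (e l) := by
  rw [← Finset.sum_image (s := Finset.univ) (g := e) (f := f) he.injOn]
  refine (Finset.sum_subset (Finset.subset_univ _) fun x _ hx => hf x ?_).symm
  simpa using hx

/-- The vanishing of `C` and `B` off the block makes each product restrict to the block `e`. The
correction term is then the part of `∑ y, V j y * W y k` over the range of `e`, and of the rest only
`y = x` survives. -/
theorem quasiDet_of_factor {m : ℕ} {e : Fin m → Fin n} (he : Function.Injective e)
    {A : Matrix (Fin (m + 1)) (Fin (m + 1)) R} {p q : Fin (m + 1)}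
    {C B V W : Matrix (Fin n) (Fin n) R} {j k x : Fin n}
    (hCu : IsUnit (C.submatrix e e)) (hBu : IsUnit (B.submatrix e e))
    (hC : ∀ l y, y ∉ Set.range e → C (e l) y = 0) (hB : ∀ c y, y ∉ Set.range e → B y (e c) = 0)
    (hA : ∀ l c, A (p.succAbove l) (q.succAbove c) = (C * B) (e l) (e c))
    (hrow : ∀ c, A p (q.succAbove c) = (V * B) j (e c))
    (hcol : ∀ l, A (p.succAbove l) q = (C * W) (e l) k)
    (hpq : A p q = (V * W) j k) (hx : x ∉ Set.range e)
    (hVW : ∀ y, y ∉ Set.range e → y ≠ x → V j y * W y k = 0) :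
    QuasiDetDefined A p q ∧ quasiDet A p q = V j x * W x k := by
  have key := quasiDet_of_minor_factor (A := A) (p := p) (q := q) (v := fun l => V j (e l))
    (w := fun l => W (e l) k) hCu hBu
    (by
      ext l c
      rw [minorMat, submatrix_apply, hA, mul_apply, mul_apply]
      exact sum_comp_of_eq_zero he fun y hy => by rw [hC l y hy, zero_mul])
    (by
      funext c
      rw [hrow, mul_apply]
      exact sum_comp_of_eq_zero he fun y hy => by rw [hB c y hy, mul_zero])
    (by
      funext l
      rw [hcol, mul_apply]
      exact sum_comp_of_eq_zero he fun y hy => by rw [hC l y hy, zero_mul])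
  refine ⟨key.1, ?_⟩
  -- Removing the term at `x` leaves a summand supported on the range of `e`.
  have hsum : ∑ y, (V j y * W y k - if y = x then V j x * W x k else 0) =
      ∑ l, (V j (e l) * W (e l) k - if e l = x then V j x * W x k else 0) := by
    refine sum_comp_of_eq_zero he fun y hy => ?_
    by_cases h : y = x
    · subst h; simp
    · simp [h, hVW y hy h]
  have hne : ∀ l, e l ≠ x := fun l h => hx ⟨l, h⟩
  simp only [hne, if_false, sub_zero, Finset.sum_sub_distrib, Finset.sum_ite_eq', Finset.mem_univ,
    if_true] at hsum
  rw [key.2, hpq, mul_apply, dotProduct, ← hsum, sub_sub_cancel]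

end QuasiDet

/-! ### Telescoping ordered products -/

section Products

variable {R : Type*} [Ring R] {n : ℕ}

/-- An ordered product is evaluated by guessing its partial products `w` and checking one recursion
step. -/
theorem prod_ofFn_eq {g : Fin n → R} {w : Fin (n + 1) → R} (h0 : w 0 = 1)
    (hw : ∀ k : Fin n, w k.succ = w k.castSucc * g k) (m : ℕ) (hm : m ≤ n) :
    (List.ofFn fun k : Fin m => g ⟨k, k.isLt.trans_le hm⟩).prod = w ⟨m, Nat.lt_succ_of_le hm⟩ := by
  induction m with
  | zero => simpa using h0.symm
  | succ m ih =>
    rw [List.ofFn_succ', List.concat_eq_append, List.prod_append, List.prod_singleton]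
    exact (congrArg (· * _) (ih (Nat.le_of_succ_le hm))).trans (hw ⟨m, hm⟩).symm

theorem prod_reverse_ofFn_eq {g : Fin n → R} {w : Fin (n + 1) → R} (h0 : w 0 = 1)
    (hw : ∀ k : Fin n, w k.succ = g k * w k.castSucc) (m : ℕ) (hm : m ≤ n) :
    (List.ofFn fun k : Fin m => g ⟨k, k.isLt.trans_le hm⟩).reverse.prod =
      w ⟨m, Nat.lt_succ_of_le hm⟩ := by
  induction m with
  | zero => simpa using h0.symm
  | succ m ih =>
    rw [List.ofFn_succ', List.concat_eq_append, List.reverse_append, List.prod_append,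
      List.reverse_singleton, List.prod_singleton]
    exact (congrArg (_ * ·) (ih (Nat.le_of_succ_le hm))).trans (hw ⟨m, hm⟩).symm

theorem prodUp_eq {g : Fin n → R} {w : Fin (n + 1) → R} (h0 : w 0 = 1)
    (hw : ∀ k : Fin n, w k.succ = w k.castSucc * g k) (i : Fin n) :
    prodUp i g = w i.castSucc :=
  prod_ofFn_eq h0 hw i i.isLt.le

theorem prodDown_eq {g : Fin n → R} {w : Fin (n + 1) → R} (h0 : w 0 = 1)
    (hw : ∀ k : Fin n, w k.succ = g k * w k.castSucc) (i : Fin n) :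
    prodDown i g = w i.castSucc :=
  prod_reverse_ofFn_eq h0 hw i i.isLt.le

theorem exists_units_recursion (g : Fin n → Rˣ → Rˣ) :
    ∃ w : Fin (n + 1) → Rˣ, w 0 = 1 ∧ ∀ k : Fin n, w k.succ = g k (w k.castSucc) :=
  ⟨Fin.induction 1 g, rfl, fun _ => rfl⟩

end Products

/-! ### Leading and trailing blocks -/

section Order

open Matrix

variable {R : Type*} [Ring R] {n : ℕ}

/-- The weight for which the block triangular matrices are the lower triangular ones. -/
def revVal (i : Fin n) : ℕ := (Fin.rev i : ℕ)

theorem revVal_injective : Function.Injective (revVal (n := n)) :=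
  Fin.val_injective.comp Fin.rev_injective

theorem revVal_lt_revVal {i j : Fin n} : revVal i < revVal j ↔ j < i := Fin.rev_lt_rev

theorem before_injective (i : Fin n) : Function.Injective (before i) := fun _ _ h =>
  Fin.ext (Fin.ext_iff.1 h :)

theorem mem_range_before {i x : Fin n} : x ∈ Set.range (before i) ↔ x < i :=
  ⟨by rintro ⟨l, rfl⟩; exact l.isLt, fun h => ⟨⟨x, h⟩, rfl⟩⟩

theorem after_injective (i : Fin n) : Function.Injective (after i) := fun a b h => by
  have := congrArg Fin.val h
  simp only [after] at this
  exact Fin.ext (by omega)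

theorem mem_range_after {i x : Fin n} : x ∈ Set.range (after i) ↔ i < x := by
  constructor
  · rintro ⟨l, rfl⟩
    rw [Fin.lt_def]
    simp only [after]
    omega
  · intro h
    rw [Fin.lt_def] at h
    exact ⟨⟨x - (i + 1), by omega⟩, Fin.ext (by simp only [after]; omega)⟩

@[simp]
theorem beforeThen_castSucc (i j : Fin n) (c : Fin i) : beforeThen i j c.castSucc = before i c := by
  simp [beforeThen]

@[simp]
theorem beforeThen_last (i j : Fin n) : beforeThen i j (Fin.last i) = j := by
  simp [beforeThen]

@[simp]
theorem thenAfter_succ (i j : Fin n) (c : Fin (n - 1 - i)) :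
    thenAfter j i c.succ = after i c := by
  simp [thenAfter]

@[simp]
theorem thenAfter_zero (i j : Fin n) : thenAfter j i 0 = j := by
  simp [thenAfter]

theorem isLPair_iff {P M : Matrix (Fin n) (Fin n) R} : IsLPair P M ↔
    ∃ u : Fin (n + 1) → Rˣ, u 0 = 1 ∧ P.BlockTriangular Fin.val ∧ M.BlockTriangular revVal ∧
      (∀ i : Fin n, P i i = u i.succ) ∧ (∀ i : Fin n, M i i = u i.castSucc) := by
  simp only [IsLPair, BlockTriangular, revVal_lt_revVal, Fin.lt_def]

/-- The quasi-determinant relative to the leading block of `L * U`, with `L` lower and `U` upper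
triangular. -/
theorem quasiDet_last_of_factor {L U V W : Matrix (Fin n) (Fin n) R}
    (hL : L.BlockTriangular revVal) (hLu : ∀ i, IsUnit (L i i))
    (hU : U.BlockTriangular Fin.val) (hUu : ∀ i, IsUnit (U i i)) {i j k : Fin n}
    {A : Matrix (Fin (i + 1)) (Fin (i + 1)) R}
    (hA : ∀ l c : Fin i, A l.castSucc c.castSucc = (L * U) (before i l) (before i c))
    (hrow : ∀ c : Fin i, A (Fin.last i) c.castSucc = (V * U) j (before i c))
    (hcol : ∀ l : Fin i, A l.castSucc (Fin.last i) = (L * W) (before i l) k)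
    (hpq : A (Fin.last i) (Fin.last i) = (V * W) j k)
    (hVW : ∀ y, i < y → V j y * W y k = 0) :
    QuasiDetDefined A (Fin.last i) (Fin.last i) ∧
      quasiDet A (Fin.last i) (Fin.last i) = V j i * W i k := by
  -- `V` and `W` stay independent of `L` and `U`, so that the border may come from another product
  -- sharing a factor with `L * U`.
  refine quasiDet_of_factor (before_injective i) (C := L) (B := U) (V := V) (W := W)
    (isUnit_of_triangular (revVal_injective.comp (before_injective i)) hL.submatrix
      fun l => hLu _)
    (isUnit_of_triangular (Fin.val_injective.comp (before_injective i)) hU.submatrix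
      fun l => hUu _) ?_ ?_ ?_ ?_ ?_ hpq ?_ ?_
  · intro l y hy
    rw [mem_range_before, not_lt] at hy
    exact hL (revVal_lt_revVal.2 (lt_of_lt_of_le (mem_range_before.1 ⟨l, rfl⟩) hy))
  · intro l y hy
    rw [mem_range_before, not_lt] at hy
    exact hU (lt_of_lt_of_le (mem_range_before.1 ⟨l, rfl⟩) hy)
  · simpa only [Fin.succAbove_last] using hA
  · simpa only [Fin.succAbove_last] using hrow
  · simpa only [Fin.succAbove_last] using hcol
  · rw [mem_range_before]; exact lt_irrefl i
  · intro y hy hne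
    rw [mem_range_before, not_lt] at hy
    exact hVW y (lt_of_le_of_ne hy hne.symm)

/-- The quasi-determinant relative to the trailing block of `U * L`, with `L` lower and `U` upper
triangular. -/
theorem quasiDet_zero_of_factor {U L V W : Matrix (Fin n) (Fin n) R}
    (hL : L.BlockTriangular revVal) (hLu : ∀ i, IsUnit (L i i))
    (hU : U.BlockTriangular Fin.val) (hUu : ∀ i, IsUnit (U i i)) {i j k : Fin n}
    {A : Matrix (Fin (n - 1 - i + 1)) (Fin (n - 1 - i + 1)) R}
    (hA : ∀ l c, A (Fin.succ l) (Fin.succ c) = (U * L) (after i l) (after i c))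
    (hrow : ∀ c, A 0 (Fin.succ c) = (V * L) j (after i c))
    (hcol : ∀ l, A (Fin.succ l) 0 = (U * W) (after i l) k)
    (hpq : A 0 0 = (V * W) j k)
    (hVW : ∀ y, y < i → V j y * W y k = 0) :
    QuasiDetDefined A 0 0 ∧ quasiDet A 0 0 = V j i * W i k := by
  refine quasiDet_of_factor (after_injective i) (C := U) (B := L) (V := V) (W := W)
    (isUnit_of_triangular (Fin.val_injective.comp (after_injective i)) hU.submatrix
      fun l => hUu _)
    (isUnit_of_triangular (revVal_injective.comp (after_injective i)) hL.submatrix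
      fun l => hLu _) ?_ ?_ ?_ ?_ ?_ hpq ?_ ?_
  · intro l y hy
    rw [mem_range_after, not_lt] at hy
    exact hU (lt_of_le_of_lt hy (mem_range_after.1 ⟨l, rfl⟩))
  · intro l y hy
    rw [mem_range_after, not_lt] at hy
    exact hL (revVal_lt_revVal.2 (lt_of_le_of_lt hy (mem_range_after.1 ⟨l, rfl⟩)))
  · simpa only [Fin.zero_succAbove] using hA
  · simpa only [Fin.zero_succAbove] using hrow
  · simpa only [Fin.zero_succAbove] using hcol
  · rw [mem_range_after]; exact lt_irrefl i
  · intro y hy hne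
    rw [mem_range_after, not_lt] at hy
    exact hVW y (lt_of_le_of_ne hy hne)

end Order

/-! ### LU and UL factorization by elimination -/

section Elimination

open Matrix

variable {R : Type*} [Ring R] {n : ℕ}

/-- Row elimination: the rows preceding `k` (in the order given by `b`) eliminate the entries of
the row `k` in the preceding columns. -/
theorem exists_elimination_matrix (A : Matrix (Fin n) (Fin n) R) (b : Fin n → ℕ) (d : Fin n → ℕ)
    (e : ∀ k, Fin (d k) → Fin n) (he : ∀ k x, x ∈ Set.range (e k) ↔ b x < b k) (h : Fin n → R)
    (hv : ∀ k, ∃ v : Fin (d k) → R, (∀ c, A k (e k c) = ∑ l, v l * A (e k l) (e k c)) ∧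
      h k = A k k - ∑ l, v l * A (e k l) k) :
    ∃ T : Matrix (Fin n) (Fin n) R, (∀ i j, b i < b j → T i j = 0) ∧ (∀ i, T i i = 1) ∧
      (T * A).BlockTriangular b ∧ ∀ i, (T * A) i i = h i := by
  choose v hv hh using hv
  -- Row `k` of `T * A` is row `k` of `A` minus the combination of preceding rows with coefficients
  -- `v k`.
  let T : Matrix (Fin n) (Fin n) R := of fun k x =>
    (if k = x then 1 else 0) - ∑ l, if e k l = x then v k l else 0
  have hTA : ∀ k j, (T * A) k j = A k j - ∑ l, v k l * A (e k l) j := by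
    intro k j
    simp only [T, mul_apply, of_apply, sub_mul, Finset.sum_sub_distrib, ite_mul, one_mul, zero_mul,
      Finset.sum_ite_eq, Finset.mem_univ, if_true, Finset.sum_mul]
    rw [Finset.sum_comm]
    simp
  have hlt : ∀ k l, b (e k l) < b k := fun k l => (he k _).1 ⟨l, rfl⟩
  refine ⟨T, fun i j hij => ?_, fun i => ?_, fun i j hij => ?_, fun i => ?_⟩
  · have h1 : i ≠ j := by rintro rfl; exact lt_irrefl _ hij
    have h2 : ∀ l, e i l ≠ j := by rintro l rfl; exact lt_asymm hij (hlt i l)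
    simp [T, h1, h2]
  · have h2 : ∀ l, e i l ≠ i := fun l hl => by
      have := hlt i l
      rw [hl] at this
      exact lt_irrefl _ this
    simp [T, h2]
  · obtain ⟨c, rfl⟩ := (he i j).2 hij
    rw [hTA, ← hv, sub_self]
  · rw [hTA, ← hh]

/-- Regularity of the leading blocks gives an `LU` decomposition. -/
theorem exists_lower_mul_upper {A : Matrix (Fin n) (Fin n) R} (hA : InitRegular A) :
    ∃ L U : Matrix (Fin n) (Fin n) R, L.BlockTriangular revVal ∧ U.BlockTriangular Fin.val ∧
      (∀ i, L i i = 1) ∧ (∀ i, U i i = hInit A i) ∧ L * U = A := by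
  obtain ⟨T, hT, hT1, hTA, hd⟩ := exists_elimination_matrix A Fin.val (fun k => k)
    (fun k => before k) (fun k x => mem_range_before) (hInit A) (fun k => by
      obtain ⟨v, hv, h⟩ := exists_row_elimination (hA k).1
      exact ⟨v, by simpa using hv, by simpa [hInit, qInit] using h⟩)
  obtain ⟨L, hL, hTL, hLT, hL1⟩ := exists_triangular_inverse revVal_injective (M := T)
    (fun i j hij => hT i j (revVal_lt_revVal.1 hij)) (fun _ => 1) (by simpa using hT1)
  exact ⟨L, T * A, hL, hTA, by simpa using hL1, hd, by rw [← mul_assoc, hLT, one_mul]⟩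

/-- Regularity of the trailing blocks gives a `UL` decomposition. -/
theorem exists_upper_mul_lower {A : Matrix (Fin n) (Fin n) R} (hA : TailRegular A) :
    ∃ U L : Matrix (Fin n) (Fin n) R, U.BlockTriangular Fin.val ∧ L.BlockTriangular revVal ∧
      (∀ i, U i i = 1) ∧ (∀ i, L i i = hTail A i) ∧ U * L = A := by
  -- Under the reversed weight the preceding rows are those of larger index.
  obtain ⟨T, hT, hT1, hTA, hd⟩ := exists_elimination_matrix A revVal (fun k => n - 1 - k)
    (fun k => after k) (fun k x => by rw [mem_range_after, revVal_lt_revVal]) (hTail A) (fun k => by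
      obtain ⟨v, hv, h⟩ := exists_row_elimination (hA k).1
      exact ⟨v, by simpa using hv, by simpa [hTail, qTail] using h⟩)
  obtain ⟨U, hU, hTU, hUT, hU1⟩ := exists_triangular_inverse Fin.val_injective (M := T)
    (fun i j hij => hT i j (revVal_lt_revVal.2 hij)) (fun _ => 1) (by simpa using hT1)
  exact ⟨U, T * A, hU, hTA, by simpa using hU1, hd, by rw [← mul_assoc, hUT, one_mul]⟩

end Elimination

/-! ### Determination and existence of partners -/

section ZeroCurvature

open Matrix

variable {R : Type*} [Ring R] {n : ℕ}

/-- In every solution of the zero-curvature relation, `Y` is co-regular and determines `X`. -/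
theorem ZeroCurvature.initRegular_and_eq {X Y : LData n R} (hX : X.Admissible)
    (hY : Y.Admissible) (h : ZeroCurvature X Y) : InitRegular Y.Jt ∧ X = backwardMap Y := by
  obtain ⟨hX1, hX2⟩ := hX
  obtain ⟨hY1, hY2⟩ := hY
  obtain ⟨u₁, hu₁, hp1, hm1, dp1, dm1⟩ := isLPair_iff.1 hX1
  obtain ⟨u₂, hu₂, hp2, hm2, dp2, dm2⟩ := isLPair_iff.1 hX2
  obtain ⟨v₁, hv₁, hq1, -, dq1, -⟩ := isLPair_iff.1 hY1
  obtain ⟨v₂, hv₂, hq2, -, dq2, -⟩ := isLPair_iff.1 hY2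
  obtain ⟨h1, h2, h3⟩ := h
  have hL : ∀ i, IsUnit (X.m1 i i) := fun i => by rw [dm1]; exact Units.isUnit _
  have hU : ∀ i, IsUnit (X.p2 i i) := fun i => by rw [dp2]; exact Units.isUnit _
  have hJ : Y.Jt = X.m1 * X.p2 := h2.symm
  have hd : ∀ k : Fin n, Y.p2 k k * Y.p1 k k = (u₁ k.succ * u₂ k.succ : Rˣ) := fun k => by
    rw [← triangular_mul_diag Fin.val_injective hq2 hq1, ← h1,
      triangular_mul_diag Fin.val_injective hp1 hp2, dp1, dp2, Units.val_mul]
  have hq : ∀ i j k : Fin n, i = j ∨ i = k →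
      QuasiDetDefined (Y.Jt.submatrix (beforeThen i j) (beforeThen i k)) (Fin.last i)
        (Fin.last i) ∧ qInit Y.Jt i j k = X.m1 j i * X.p2 i k := by
    intro i j k hijk
    refine quasiDet_last_of_factor hm1 hL hp2 hU (V := X.m1) (W := X.p2) (j := j) (k := k)
      ?_ ?_ ?_ ?_ ?_
    · simp [hJ]
    · simp [hJ]
    · simp [hJ]
    · simp [hJ]
    · intro y hy
      rcases hijk with rfl | rfl
      · rw [hm1 (revVal_lt_revVal.2 hy), zero_mul]
      · rw [hp2 hy, mul_zero]
  have hH : ∀ k, hInit Y.Jt k = (u₁ k.castSucc * u₂ k.succ : Rˣ) := fun k => by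
    rw [hInit, (hq k k k (Or.inl rfl)).2, dm1, dp2, Units.val_mul]
  have hdown : ∀ i, prodDown i (fun k => Y.p2 k k * Y.p1 k k * Ring.inverse (hInit Y.Jt k)) =
      u₁ i.castSucc := by
    -- The factor is `u₁ k.succ * (u₁ k.castSucc)⁻¹`, since `u₂ k.succ` cancels.
    refine prodDown_eq (w := fun i => (u₁ i : R)) (by simp [hu₁]) fun k => ?_
    rw [hd, hH, Ring.inverse_unit, ← Units.val_mul, ← Units.val_mul]
    congr 1
    group
  have hup : ∀ i, prodUp i (fun k => hInit Y.Jt k * Ring.inverse (Y.p2 k k * Y.p1 k k)) =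
      ((u₁ i.castSucc)⁻¹ : Rˣ) := by
    refine prodUp_eq (w := fun i => (((u₁ i)⁻¹ : Rˣ) : R)) (by simp [hu₁]) fun k => ?_
    rw [hd, hH, Ring.inverse_unit, ← Units.val_mul, ← Units.val_mul]
    congr 1
    group
  refine ⟨fun k => ⟨(hq k k k (Or.inl rfl)).1, hH k ▸ Units.isUnit _⟩, ?_⟩
  ext i j
  · simp only [backwardMap, of_apply]
    split_ifs with hij
    · have hr : quasiDet (rowInit Y.Jt (Y.p2 * Y.p1) i j) (Fin.last j) (Fin.last j) =
          X.p1 i j * X.p2 j j := by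
        refine (quasiDet_last_of_factor hm1 hL hp2 hU (V := X.p1) (W := X.p2) (j := i) (k := j)
          ?_ ?_ ?_ ?_ ?_).2
        · simp [rowInit, hJ]
        · simp [rowInit, h1]
        · simp [rowInit, hJ]
        · simp [rowInit, h1]
        · intro y hy
          rw [hp2 hy, mul_zero]
      rw [hr, hdown, hH, Ring.inverse_unit, dp2, mul_assoc, mul_assoc, ← Units.val_mul,
        ← Units.val_mul]
      simp
    · exact hp1 (not_le.1 hij)
  · simp only [backwardMap, of_apply]
    split_ifs with hij
    · rw [(hq j i j (Or.inr rfl)).2, hdown, hH, Ring.inverse_unit, dp2, mul_assoc, mul_assoc,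
        ← Units.val_mul, ← Units.val_mul]
      simp
    · exact hm1 (revVal_lt_revVal.2 (not_le.1 hij))
  · simp only [backwardMap, of_apply]
    split_ifs with hij
    · rw [(hq i i j (Or.inl rfl)).2, hup, dm1, Units.inv_mul_cancel_left]
    · exact hp2 (not_le.1 hij)
  · simp only [backwardMap, of_apply]
    split_ifs with hij
    · have hr : quasiDet (colInit Y.Jt (Y.m2 * Y.m1) i j) (Fin.last i) (Fin.last i) =
          X.m1 i i * X.m2 i j := by
        refine (quasiDet_last_of_factor hm1 hL hp2 hU (V := X.m1) (W := X.m2) (j := i) (k := j)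
          ?_ ?_ ?_ ?_ ?_).2
        · simp [colInit, hJ]
        · simp [colInit, hJ]
        · simp [colInit, h3]
        · simp [colInit, h3]
        · intro y hy
          rw [hm1 (revVal_lt_revVal.2 hy), zero_mul]
      rw [hr, hup, dm1, Units.inv_mul_cancel_left]
    · exact hm2 (revVal_lt_revVal.2 (not_le.1 hij))

/-- In every solution of the zero-curvature relation, `X` is regular and determines `Y`. -/
theorem ZeroCurvature.tailRegular_and_eq {X Y : LData n R} (hX : X.Admissible)
    (hY : Y.Admissible) (h : ZeroCurvature X Y) : TailRegular X.J ∧ Y = forwardMap X := by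
  obtain ⟨hX1, hX2⟩ := hX
  obtain ⟨hY1, hY2⟩ := hY
  obtain ⟨u₁, hu₁, hp1, -, dp1, -⟩ := isLPair_iff.1 hX1
  obtain ⟨u₂, hu₂, hp2, -, dp2, -⟩ := isLPair_iff.1 hX2
  obtain ⟨v₁, hv₁, hq1, hm1, dq1, dm1⟩ := isLPair_iff.1 hY1
  obtain ⟨v₂, hv₂, hq2, hm2, dq2, dm2⟩ := isLPair_iff.1 hY2
  obtain ⟨h1, h2, h3⟩ := h
  have hL : ∀ i, IsUnit (Y.m1 i i) := fun i => by rw [dm1]; exact Units.isUnit _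
  have hU : ∀ i, IsUnit (Y.p2 i i) := fun i => by rw [dq2]; exact Units.isUnit _
  have hJ : X.J = Y.p2 * Y.m1 := h2
  have hd : ∀ k : Fin n, X.p1 k k * X.p2 k k = (v₂ k.succ * v₁ k.succ : Rˣ) := fun k => by
    rw [← triangular_mul_diag Fin.val_injective hp1 hp2, h1,
      triangular_mul_diag Fin.val_injective hq2 hq1, dq1, dq2, Units.val_mul]
  have hq : ∀ i j k : Fin n, i = j ∨ i = k →
      QuasiDetDefined (X.J.submatrix (thenAfter j i) (thenAfter k i)) 0 0 ∧
        qTail X.J i j k = Y.p2 j i * Y.m1 i k := by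
    intro i j k hijk
    refine quasiDet_zero_of_factor hm1 hL hq2 hU (V := Y.p2) (W := Y.m1) (j := j) (k := k)
      ?_ ?_ ?_ ?_ ?_
    · simp [hJ]
    · simp [hJ]
    · simp [hJ]
    · simp [hJ]
    · intro y hy
      rcases hijk with rfl | rfl
      · rw [hq2 hy, zero_mul]
      · rw [hm1 (revVal_lt_revVal.2 hy), mul_zero]
  have hH : ∀ k, hTail X.J k = (v₂ k.succ * v₁ k.castSucc : Rˣ) := fun k => by
    rw [hTail, (hq k k k (Or.inl rfl)).2, dm1, dq2, Units.val_mul]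
  have hup : ∀ i, prodUp i (fun k => Ring.inverse (hTail X.J k) * (X.p1 k k * X.p2 k k)) =
      v₁ i.castSucc := by
    refine prodUp_eq (w := fun i => (v₁ i : R)) (by simp [hv₁]) fun k => ?_
    rw [hd, hH, Ring.inverse_unit, ← Units.val_mul, ← Units.val_mul]
    congr 1
    group
  have hdown : ∀ i, prodDown i (fun k => Ring.inverse (X.p1 k k * X.p2 k k) * hTail X.J k) =
      ((v₁ i.castSucc)⁻¹ : Rˣ) := by
    refine prodDown_eq (w := fun i => (((v₁ i)⁻¹ : Rˣ) : R)) (by simp [hv₁]) fun k => ?_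
    rw [hd, hH, Ring.inverse_unit, ← Units.val_mul, ← Units.val_mul]
    congr 1
    group
  -- The prefactor is the inverse of `Y.p2 i i`.
  have hcancel : ∀ (i : Fin n) (a : R),
      v₁ i.castSucc * Ring.inverse (hTail X.J i) * (Y.p2 i i * a) = a := fun i a => by
    rw [hH, Ring.inverse_unit, dq2, ← Units.val_mul, ← mul_assoc, ← Units.val_mul]
    simp
  refine ⟨fun k => ⟨(hq k k k (Or.inl rfl)).1, hH k ▸ Units.isUnit _⟩, ?_⟩
  ext i j
  · simp only [forwardMap, of_apply]
    split_ifs with hij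
    · have hr : quasiDet (colTail (X.p1 * X.p2) X.J i j) 0 0 = Y.p2 i i * Y.p1 i j := by
        refine (quasiDet_zero_of_factor hm1 hL hq2 hU (V := Y.p2) (W := Y.p1) (j := i) (k := j)
          ?_ ?_ ?_ ?_ ?_).2
        · simp [colTail, hJ]
        · simp [colTail, hJ]
        · simp [colTail, h1]
        · simp [colTail, h1]
        · intro y hy
          rw [hq2 hy, zero_mul]
      rw [hr, hup, hcancel]
    · exact hq1 (not_le.1 hij)
  · simp only [forwardMap, of_apply]
    split_ifs with hij
    · rw [(hq i i j (Or.inl rfl)).2, hup, hcancel]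
    · exact hm1 (revVal_lt_revVal.2 (not_le.1 hij))
  · simp only [forwardMap, of_apply]
    split_ifs with hij
    · rw [(hq j i j (Or.inr rfl)).2, hdown, dm1, Units.mul_inv_cancel_right]
    · exact hq2 (not_le.1 hij)
  · simp only [forwardMap, of_apply]
    split_ifs with hij
    · have hr : quasiDet (rowTail (X.m1 * X.m2) X.J i j) 0 0 = Y.m2 i j * Y.m1 j j := by
        refine (quasiDet_zero_of_factor hm1 hL hq2 hU (V := Y.m2) (W := Y.m1) (j := i) (k := j)
          ?_ ?_ ?_ ?_ ?_).2
        · simp [rowTail, hJ]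
        · simp [rowTail, h3]
        · simp [rowTail, hJ]
        · simp [rowTail, h3]
        · intro y hy
          rw [hm1 (revVal_lt_revVal.2 hy), mul_zero]
      rw [hr, hdown, dm1, Units.mul_inv_cancel_right]
    · exact hm2 (revVal_lt_revVal.2 (not_le.1 hij))

/-- A co-regular `Y` has a partner `X` in the zero-curvature relation. -/
theorem exists_zeroCurvature_left {Y : LData n R} (hY : Y.Admissible) (hr : InitRegular Y.Jt) :
    ∃ X : LData n R, X.Admissible ∧ ZeroCurvature X Y := by
  obtain ⟨hY1, hY2⟩ := hY
  obtain ⟨v₁, hv₁, hq1, hm1, dq1, dm1⟩ := isLPair_iff.1 hY1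
  obtain ⟨v₂, hv₂, hq2, hm2, dq2, dm2⟩ := isLPair_iff.1 hY2
  obtain ⟨L, U, hL, hU, dL, dU, hLU⟩ := exists_lower_mul_upper hr
  choose H hH using fun k => (hr k).2
  -- `w` is to be `u⁽¹⁾`; the telescoping of the formulas forces this recursion.
  obtain ⟨w, hw0, hw⟩ := exists_units_recursion fun (k : Fin n) x =>
    v₂ k.succ * v₁ k.succ * (H k)⁻¹ * x
  let D : Matrix (Fin n) (Fin n) R := diagonal fun k => (w k.castSucc : R)
  let E : Matrix (Fin n) (Fin n) R := diagonal fun k => ((w k.castSucc)⁻¹ : Rˣ)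
  have hDE : D * E = 1 := by simp [D, E, diagonal_mul_diagonal]
  let P := E * U
  let M := L * D
  have hP : P.BlockTriangular Fin.val := (blockTriangular_diagonal _).mul hU
  have hM : M.BlockTriangular revVal := hL.mul (blockTriangular_diagonal _)
  have dP : ∀ k, P k k = ((w k.castSucc)⁻¹ * H k : Rˣ) := fun k => by
    simp [P, E, diagonal_mul, dU, ← hH]
  have dM : ∀ k : Fin n, M k k = w k.castSucc := fun k => by
    simp [M, D, mul_diagonal, dL]
  have hMP : M * P = Y.p2 * Y.m1 := by
    calc M * P = L * (D * E) * U := by simp only [M, P, mul_assoc]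
      _ = Y.p2 * Y.m1 := by rw [hDE, mul_one, hLU, LData.Jt]
  obtain ⟨P', hP', -, hPP, dP'⟩ := exists_triangular_inverse Fin.val_injective hP _ dP
  obtain ⟨M', hM', hMM, -, dM'⟩ := exists_triangular_inverse revVal_injective hM _ dM
  -- Both sides are candidates for `u⁽²⁾`. The diagonal of `P` uses it at `k.succ`, that of the
  -- fourth matrix at `k.castSucc`, so agreement is needed at every index, including `0`.
  have key : ∀ i : Fin (n + 1), (w i)⁻¹ * (v₂ i * v₁ i) =
      (Fin.cons 1 fun k => (w k.castSucc)⁻¹ * H k : Fin (n + 1) → Rˣ) i := by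
    refine Fin.cases (by simp [hw0, hv₁, hv₂]) fun k => ?_
    rw [Fin.cons_succ, hw]
    group
  -- The first and last matrices are forced by the outer equations.
  refine ⟨⟨Y.p2 * Y.p1 * P', M, P, M' * (Y.m2 * Y.m1)⟩,
    ⟨isLPair_iff.2 ⟨w, hw0, (hq2.mul hq1).mul hP', hM, fun k => ?_, dM⟩,
      isLPair_iff.2 ⟨Fin.cons 1 fun k => (w k.castSucc)⁻¹ * H k, rfl, hP,
        hM'.mul (hm2.mul hm1), dP, fun k => ?_⟩⟩, ?_, hMP, ?_⟩
  · dsimp only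
    rw [triangular_mul_diag Fin.val_injective (hq2.mul hq1) hP',
      triangular_mul_diag Fin.val_injective hq2 hq1, dP', dq1, dq2, hw, ← Units.val_mul,
      ← Units.val_mul]
    congr 1
    group
  · dsimp only
    rw [triangular_mul_diag revVal_injective hM' (hm2.mul hm1),
      triangular_mul_diag revVal_injective hm2 hm1, dM', dm1, dm2, ← key, Units.val_mul,
      Units.val_mul]
  · exact (mul_assoc _ _ _).trans (by rw [hPP, mul_one])
  · exact (mul_assoc _ _ _).symm.trans (by rw [hMM, one_mul])

/-- A regular `X` has a partner `Y` in the zero-curvature relation. -/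
theorem exists_zeroCurvature_right {X : LData n R} (hX : X.Admissible) (hr : TailRegular X.J) :
    ∃ Y : LData n R, Y.Admissible ∧ ZeroCurvature X Y := by
  obtain ⟨hX1, hX2⟩ := hX
  obtain ⟨u₁, hu₁, hp1, hm1, dp1, dm1⟩ := isLPair_iff.1 hX1
  obtain ⟨u₂, hu₂, hp2, hm2, dp2, dm2⟩ := isLPair_iff.1 hX2
  obtain ⟨U, L, hU, hL, dU, dL, hUL⟩ := exists_upper_mul_lower hr
  choose H hH using fun k => (hr k).2
  obtain ⟨w, hw0, hw⟩ := exists_units_recursion fun (k : Fin n) x =>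
    x * (H k)⁻¹ * (u₁ k.succ * u₂ k.succ)
  -- Here `w` is to be `ũ⁽¹⁾`. As `U` has unit diagonal and `L` has diagonal `H`, this choice gives
  -- `M` the diagonal `w k.castSucc`.
  let D : Matrix (Fin n) (Fin n) R := diagonal fun k => (H k * (w k.castSucc)⁻¹ : Rˣ)
  let E : Matrix (Fin n) (Fin n) R := diagonal fun k => (w k.castSucc * (H k)⁻¹ : Rˣ)
  have hDE : D * E = 1 := by
    rw [diagonal_mul_diagonal, ← diagonal_one]
    congr 1
    funext k
    rw [← Units.val_mul, ← Units.val_one]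
    congr 1
    group
  let P := U * D
  let M := E * L
  have hP : P.BlockTriangular Fin.val := hU.mul (blockTriangular_diagonal _)
  have hM : M.BlockTriangular revVal := (blockTriangular_diagonal _).mul hL
  have dP : ∀ k, P k k = (H k * (w k.castSucc)⁻¹ : Rˣ) := fun k => by
    simp [P, D, mul_diagonal, dU]
  have dM : ∀ k : Fin n, M k k = w k.castSucc := fun k => by
    simp [M, E, diagonal_mul, dL, ← hH]
  have hPM : X.m1 * X.p2 = P * M := by
    symm
    calc P * M = U * (D * E) * L := by simp only [M, P, mul_assoc]
      _ = X.m1 * X.p2 := by rw [hDE, mul_one, hUL, LData.J]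
  obtain ⟨P', hP', hPP, -, dP'⟩ := exists_triangular_inverse Fin.val_injective hP _ dP
  obtain ⟨M', hM', -, hMM, dM'⟩ := exists_triangular_inverse revVal_injective hM _ dM
  have key : ∀ i : Fin (n + 1), (u₁ i * u₂ i) * (w i)⁻¹ =
      (Fin.cons 1 fun k => H k * (w k.castSucc)⁻¹ : Fin (n + 1) → Rˣ) i := by
    refine Fin.cases (by simp [hw0, hu₁, hu₂]) fun k => ?_
    rw [Fin.cons_succ, hw]
    group
  refine ⟨⟨P' * (X.p1 * X.p2), M, P, X.m1 * X.m2 * M'⟩,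
    ⟨isLPair_iff.2 ⟨w, hw0, hP'.mul (hp1.mul hp2), hM, fun k => ?_, dM⟩,
      isLPair_iff.2 ⟨Fin.cons 1 fun k => H k * (w k.castSucc)⁻¹, rfl, hP,
        (hm1.mul hm2).mul hM', dP, fun k => ?_⟩⟩, ?_, hPM, ?_⟩
  · dsimp only
    rw [triangular_mul_diag Fin.val_injective hP' (hp1.mul hp2),
      triangular_mul_diag Fin.val_injective hp1 hp2, dP', dp1, dp2, hw, ← Units.val_mul,
      ← Units.val_mul]
    congr 1
  · dsimp only
    rw [triangular_mul_diag revVal_injective (hm1.mul hm2) hM',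
      triangular_mul_diag revVal_injective hm1 hm2, dM', dm1, dm2, ← key, Units.val_mul,
      Units.val_mul]
  · exact Eq.symm ((mul_assoc _ _ _).symm.trans (by rw [hPP, one_mul]))
  · exact Eq.symm ((mul_assoc _ _ _).trans (by rw [hMM, mul_one]))

end ZeroCurvature

end QYB

theorem theorem2p4 {R : Type*} [Ring R] (n : ℕ) :
    -- the formulas solve the zero-curvature relation, and the forward map undoes them
    (∀ Y : QYB.LData n R, Y.Admissible → QYB.InitRegular Y.Jt →
      (QYB.backwardMap Y).Admissible ∧
      QYB.ZeroCurvature (QYB.backwardMap Y) Y ∧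
      QYB.TailRegular (QYB.backwardMap Y).J ∧
      QYB.forwardMap (QYB.backwardMap Y) = Y) ∧
    -- the formulas undo the forward map
    (∀ X : QYB.LData n R, X.Admissible → QYB.TailRegular X.J →
      (QYB.forwardMap X).Admissible ∧
      QYB.InitRegular (QYB.forwardMap X).Jt ∧
      QYB.backwardMap (QYB.forwardMap X) = X) ∧
    -- in every solution of the zero-curvature relation `X` is given by the formulas in `Y`
    (∀ X Y : QYB.LData n R, X.Admissible → Y.Admissible → QYB.ZeroCurvature X Y →
      QYB.InitRegular Y.Jt ∧ X = QYB.backwardMap Y) := by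
  refine ⟨fun Y hY hr => ?_, fun X hX hr => ?_, fun X Y hX hY h => h.initRegular_and_eq hX hY⟩
  -- Any partner will do: it must equal `backwardMap Y`, and its forward image must be `Y`.
  · obtain ⟨X, hX, h⟩ := QYB.exists_zeroCurvature_left hY hr
    obtain ⟨-, hXY⟩ := h.initRegular_and_eq hX hY
    obtain ⟨hreg, hYX⟩ := h.tailRegular_and_eq hX hY
    rw [← hXY]
    exact ⟨hX, h, hreg, hYX.symm⟩
  · obtain ⟨Y, hY, h⟩ := QYB.exists_zeroCurvature_right hX hr
    obtain ⟨hreg, hXY⟩ := h.initRegular_and_eq hX hY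
    obtain ⟨-, hYX⟩ := h.tailRegular_and_eq hX hY
    rw [← hYX]
    exact ⟨hY, hreg, hXY.symm⟩
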